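/- Let $B(n)$, for an integer $n\ge 0$, be the number of partition triples $(\pi_1,\pi_2,\pi_3)$ of $n$ (the sizes of the three partitions, each possibly empty, add up to $n$) such that $\pi_1$ and $\pi_2$ each consist of distinct odd parts and $\pi_3$ consists of parts divisible by $4$; put $B(m)=0$ for integers $m<0$. Then for all primes $p\equiv 3\pmod 4$ with $p\ge 5$, all integers $n\ge 0$, and all $r\in\{1,\ldots,p-1\}$, the sum below has only finitely many nonzero terms and $$\sum_{k=-\infty}^{\infty}(-1)^k B\left(9p^2n+9pr+\frac{9(p^2-1)}{4}+2-6k(3k+1)\right)\equiv 0\pmod 3.$$ -/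

import Mathlib

/-- The partitions of `n` into distinct odd parts. -/
def distinctOddPartitions (n : ℕ) : Finset n.Partition :=
  Finset.univ.filter fun π => π.parts.Nodup ∧ ∀ i ∈ π.parts, Odd i

/-- The partitions of `n` all of whose parts are divisible by `4`. -/
def fourDvdPartitions (n : ℕ) : Finset n.Partition :=
  Finset.univ.filter fun π => ∀ i ∈ π.parts, 4 ∣ i

/-- The partition triples `(π₁, π₂, π₃)` of `n` such that `π₁` and `π₂` consist of distinct odd
parts and `π₃` consists of parts divisible by `4`.  The first component of an element of the
sigma type records the sizes `(a, b, c)` of the three partitions, with `a + b + c = n`. -/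
def partitionTriples (n : ℕ) :
    Finset (Σ s : Fin 3 → ℕ, (s 0).Partition × (s 1).Partition × (s 2).Partition) :=
  (Finset.Nat.antidiagonalTuple 3 n).sigma fun s =>
    distinctOddPartitions (s 0) ×ˢ distinctOddPartitions (s 1) ×ˢ fourDvdPartitions (s 2)

/-- The restricted partition function `B`, extended by `B(m) = 0` to negative integers `m`. -/
def B (m : ℤ) : ℕ :=
  if 0 ≤ m then (partitionTriples m.toNat).card else 0

open PowerSeries PowerSeries.WithPiTopology Filter Topology Finset

/-! Write `E_k = ∏ (1 - q ^ (k n))`, `D = ∏ (1 + q ^ (2 i + 1))` and `ψ = ∑ q ^ (s (s + 1) / 2)`.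
The generating function of `B` is `D ^ 2 / E_4`. Gauss's identity gives `D * E_4 = ψ`, and `E_12 =
E_4 ^ 3` mod 3, so `(D ^ 2 / E_4) * E_12 = ψ ^ 2` mod 3. By the pentagonal number theorem `E_12 = ∑
(-1) ^ k q ^ (6 k (3 k + 1))`, so the alternating sum is a coefficient of `ψ ^ 2` mod 3
(`finsum_negOnePow_mul_B`). At the index `N` in question, `p` divides `4 N + 1` exactly once, so `2
(4 N + 1)` is not a sum of two squares and `N` is not a sum of two triangular numbers
(`not_eq_triangular_add_triangular`). -/

/-- Shanks's finite form of Gauss's identity `∑ q ^ (n (n + 1) / 2) = ∏ (1 - q ^ (2 n)) / (1 - q ^ (2 n - 1))`;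
`v i` stands for the inverse of `1 - q ^ (2 i + 1)`. -/
theorem sum_pow_triangle_eq {R : Type*} [CommRing R] (q : R) (v : ℕ → R)
    (hv : ∀ i, (1 - q ^ (2 * i + 1)) * v i = 1) (n : ℕ) :
    ∑ s ∈ range (2 * n), q ^ (s * (s + 1) / 2) =
      ∑ s ∈ range n, (∏ i ∈ Ico s n, (1 - q ^ (2 * i + 2)) * v i) * q ^ (s * (2 * n + 1)) := by
  induction n with
  | zero => simp
  | succ n ih =>
    -- Replacing `n` by `n + 1` changes the partial sums by a telescoping amount, given here in
    -- closed form.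
    have key : ∀ m ≤ n,
        ∑ s ∈ range m, (∏ i ∈ Ico s (n + 1), (1 - q ^ (2 * i + 2)) * v i) *
            q ^ (s * (2 * (n + 1) + 1)) =
          ∑ s ∈ range m, (∏ i ∈ Ico s n, (1 - q ^ (2 * i + 2)) * v i) * q ^ (s * (2 * n + 1)) +
          (∏ i ∈ Ico m n, (1 - q ^ (2 * i + 2)) * v i) * (1 - q ^ (2 * m)) *
            q ^ (m * (2 * n + 1)) * v n := by
      intro m
      induction m with
      | zero => simp
      | succ m ihm =>
        intro hm
        rw [sum_range_succ, sum_range_succ, ihm (by omega), prod_Ico_succ_top (by omega),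
          prod_eq_prod_Ico_succ_bot (a := m) (b := n) (by omega)]
        generalize ∏ i ∈ Ico (m + 1) n, (1 - q ^ (2 * i + 2)) * v i = A
        have e1 := hv m
        have e2 := hv n
        linear_combination (A * (1 - q ^ (2 * m + 2)) * v m * q ^ (m * (2 * n + 1))) * e2 +
          (A * (1 - q ^ (2 * m + 2)) * q ^ (m * (2 * n + 1)) * q ^ (2 * n + 1) * v n) * e1
    have e2 := hv n
    rw [sum_range_succ, key n le_rfl, ← ih, show 2 * (n + 1) = 2 * n + 1 + 1 by ring,
      sum_range_succ, sum_range_succ,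
      show 2 * n * (2 * n + 1) / 2 = n * (2 * n + 1) by rw [mul_assoc]; simp,
      show (2 * n + 1) * (2 * n + 1 + 1) / 2 = (n + 1) * (2 * n + 1) by
        rw [show (2 * n + 1) * (2 * n + 1 + 1) = 2 * ((n + 1) * (2 * n + 1)) by ring]; simp]
    simp only [Ico_self, prod_empty, Nat.Ico_succ_singleton, prod_singleton]
    linear_combination (-q ^ (n * (2 * n + 1)) - q ^ ((n + 1) * (2 * n + 1))) * e2

/-- Completing squares yields `(2 a + 1) ^ 2 + (2 b + 1) ^ 2 = 2 (4 N + 1)`. As `-1` is not a square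
mod `p`, `p` divides both bases, hence `p ^ 2` divides `4 N + 1`. -/
theorem not_eq_triangular_add_triangular {p N i j a b : ℕ} (hp : p.Prime) (hp4 : p % 4 = 3)
    (hN : p ∣ 4 * N + 1) (hN2 : ¬ p ^ 2 ∣ 4 * N + 1) (hij : i + j = N)
    (hi : i = a * (a + 1) / 2) (hj : j = b * (b + 1) / 2) : False := by
  have hi2 : 2 * i = a * (a + 1) := by
    rw [hi]; exact Nat.two_mul_div_two_of_even (Nat.even_mul_succ_self a)
  have hj2 : 2 * j = b * (b + 1) := by
    rw [hj]; exact Nat.two_mul_div_two_of_even (Nat.even_mul_succ_self b)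
  have hs : (2 * a + 1) ^ 2 + (2 * b + 1) ^ 2 = 2 * (4 * N + 1) := by
    subst hij; linarith
  have := Fact.mk hp
  have hd : ∀ x y : ℕ, p ∣ x ^ 2 + y ^ 2 → p ∣ x := by
    intro x y h
    by_contra hx
    have h0 : (x : ZMod p) ^ 2 + (y : ZMod p) ^ 2 = 0 := by
      exact_mod_cast (ZMod.natCast_eq_zero_iff _ _).2 h
    have hx0 : (x : ZMod p) ≠ 0 := fun h => hx ((ZMod.natCast_eq_zero_iff _ _).1 h)
    apply ZMod.mod_four_ne_three_of_sq_eq_neg_one (p := p) (y := (y : ZMod p) / x) _ hp4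
    field_simp
    linear_combination h0
  have h : p ∣ (2 * a + 1) ^ 2 + (2 * b + 1) ^ 2 := hs ▸ hN.mul_left 2
  have h1 := hd _ _ h
  have h2 := hd _ _ (by rwa [add_comm] at h)
  have h3 : p ^ 2 ∣ 2 * (4 * N + 1) :=
    hs ▸ (Nat.dvd_add (pow_dvd_pow_of_dvd h1 2) (pow_dvd_pow_of_dvd h2 2))
  refine hN2 (Nat.Coprime.dvd_of_dvd_mul_left ?_ h3)
  apply Nat.Coprime.pow_left
  rw [Nat.coprime_primes hp Nat.prime_two]
  rintro rfl; omega

/-! ### Generating functions of the partition classes -/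

theorem hasProd_distinctOdd {R : Type*} [CommSemiring R] [TopologicalSpace R] [T2Space R] :
    HasProd (fun i ↦ if Odd (i + 1) then 1 + (X : R⟦X⟧) ^ (i + 1) else 1)
      (PowerSeries.mk fun n ↦ (#(distinctOddPartitions n) : R)) := by
  convert! Nat.Partition.hasProd_genFun (fun i c ↦ if Odd i ∧ c ≤ 1 then (1 : R) else 0) using 1
  · ext1 i
    -- Index `j` stands for multiplicity `j + 1`, so distinctness leaves only `j = 0`.
    rw [tsum_eq_single 0]
    · split_ifs <;> simp_all
    · intro j hj
      simp [hj]
  · simp_rw [Nat.Partition.genFun, distinctOddPartitions, card_filter, Finsupp.prod, prod_boole]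
    ext n
    simp only [coeff_mk, Nat.cast_sum, Nat.cast_ite, Nat.cast_one, Nat.cast_zero]
    refine sum_congr rfl fun π _ ↦ ?_
    congr 1
    simp only [Multiset.toFinsupp_support, Multiset.mem_toFinset, Multiset.toFinsupp_apply, Multiset.nodup_iff_count_le_one]
    refine propext ⟨fun h i hi ↦ ⟨h.2 i hi, h.1 i⟩, fun h ↦ ⟨fun i ↦ ?_, fun i hi ↦ (h i hi).1⟩⟩
    by_cases hi : i ∈ π.parts
    · exact (h i hi).2
    · simp [Multiset.count_eq_zero_of_notMem hi]

theorem hasProd_fourDvd {R : Type*} [CommSemiring R] [TopologicalSpace R] [T2Space R]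
    [IsTopologicalSemiring R] :
    HasProd (fun i ↦ if 4 ∣ i + 1 then ∑' j : ℕ, (X : R⟦X⟧) ^ ((i + 1) * j) else 1)
      (PowerSeries.mk fun n ↦ (#(fourDvdPartitions n) : R)) :=
  Nat.Partition.hasProd_powerSeriesMk_card_restricted R (4 ∣ ·)

theorem coeff_mul_mul_eq_card_partitionTriples {R : Type*} [CommSemiring R] (n : ℕ) :
    coeff n ((PowerSeries.mk fun n ↦ (#(distinctOddPartitions n) : R)) *
      ((PowerSeries.mk fun n ↦ (#(distinctOddPartitions n) : R)) *
      (PowerSeries.mk fun n ↦ (#(fourDvdPartitions n) : R)))) = (#(partitionTriples n) : R) := by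
  simp only [partitionTriples, card_sigma, card_product, coeff_mul, coeff_mk, mul_sum, sum_sigma',
    Nat.cast_sum, Nat.cast_mul]
  refine sum_nbij' (fun x ↦ ![x.1.1, x.2.1, x.2.2]) (fun s ↦ ⟨(s 0, s 1 + s 2), (s 1, s 2)⟩) ?_ ?_ ?_ ?_ ?_
  · rintro ⟨⟨a, b⟩, c, d⟩ h
    simp [Finset.Nat.mem_antidiagonalTuple, Fin.sum_univ_three] at h ⊢
    omega
  · intro s h
    simp [Finset.Nat.mem_antidiagonalTuple, Fin.sum_univ_three] at h ⊢
    omega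
  · rintro ⟨⟨a, b⟩, c, d⟩ h
    simp at h
    simp [h.2]
  · intro s h
    ext i; fin_cases i <;> rfl
  · rintro ⟨⟨a, b⟩, c, d⟩ h
    rfl

/-! ### Infinite products and Gauss's identity -/

section Topology

variable {R : Type*} [CommRing R] [TopologicalSpace R]

theorem continuous_expand (k : ℕ) (hk : k ≠ 0) :
    Continuous (expand k hk : R⟦X⟧ →ₐ[R] R⟦X⟧) := by
  rw [continuous_iff_continuousAt]
  intro f
  rw [ContinuousAt, tendsto_iff_coeff_tendsto]
  intro d
  simp only [coeff_expand]
  split_ifs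
  · exact (continuous_coeff R _).continuousAt
  · exact tendsto_const_nhds

theorem hasProd_one_sub_X_pow_mul (k : ℕ) (hk : k ≠ 0) :
    HasProd (fun n ↦ (1 - X ^ (k * (n + 1)) : R⟦X⟧)) (expand k hk (pentagonalSeries R)) := by
  convert (hasProd_one_sub_X_pow R).map (expand k hk) (continuous_expand k hk) using 2 with n
  simp [pow_mul, expand_X]

theorem multipliable_one_add_C_mul_X_pow (c : R) {a b : ℕ} (ha : a ≠ 0) :
    Multipliable fun i ↦ (1 + C c * X ^ (a * i + b) : R⟦X⟧) := by
  nontriviality R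
  apply multipliable_one_add_of_tendsto_order_atTop_nhds_top
  refine ENat.tendsto_nhds_top_iff_natCast_lt.mpr fun n ↦ eventually_atTop.mpr ⟨n + 1, fun m hm ↦ ?_⟩
  grw [← le_order_mul, order_X_pow]
  refine lt_add_of_nonneg_of_lt (by simp) ?_
  norm_cast
  nlinarith [Nat.pos_of_ne_zero ha]

open Classical in
/-- The series `∑ X ^ (n (n + 1) / 2)`. -/
noncomputable def triangularSeries (R : Type*) [CommRing R] : R⟦X⟧ :=
  .mk fun n ↦ if ∃ s, s * (s + 1) / 2 = n then 1 else 0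

theorem tendsto_sum_triangular :
    Tendsto (fun n ↦ ∑ s ∈ range (2 * n), (X : R⟦X⟧) ^ (s * (s + 1) / 2)) atTop
      (𝓝 (triangularSeries R)) := by
  have hinj : Function.Injective fun s : ℕ ↦ s * (s + 1) / 2 := by
    refine (strictMono_nat_of_lt_succ fun s ↦ ?_).injective
    rw [show (s + 1) * (s + 1 + 1) = s * (s + 1) + (s + 1) * 2 by ring, Nat.add_mul_div_right _ _ two_pos]
    omega
  rw [tendsto_iff_coeff_tendsto]
  refine fun d ↦ tendsto_atTop_of_eventually_const (i₀ := d + 1) fun n hn ↦ ?_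
  simp only [map_sum, coeff_X_pow, triangularSeries, coeff_mk]
  split_ifs with h
  · obtain ⟨s, hs⟩ := h
    rw [sum_eq_single s]
    · simp [hs]
    · intro t _ ht
      rw [if_neg]
      rintro rfl
      exact ht (hinj hs).symm
    · intro h
      simp only [mem_range, not_lt] at h
      have : s ≤ s * (s + 1) / 2 := by
        rw [Nat.le_div_iff_mul_le two_pos]; nlinarith
      omega
  · refine sum_eq_zero fun s _ ↦ if_neg fun hs ↦ h ⟨s, hs.symm⟩

theorem triangularSeries_mul_tprod_one_sub_X_pow_odd [IsTopologicalRing R] [T2Space R] :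
    triangularSeries R * ∏' i, (1 - X ^ (2 * i + 1) : R⟦X⟧) = expand 2 two_ne_zero (pentagonalSeries R) := by
  nontriviality R
  have hm : Multipliable fun i ↦ (1 - X ^ (2 * i + 1) : R⟦X⟧) := by
    simpa [sub_eq_add_neg] using multipliable_one_add_C_mul_X_pow (-1 : R) (b := 1) two_ne_zero
  have h1 := tendsto_sum_triangular (R := R) |>.mul hm.tendsto_prod_tprod_nat
  have h2 := (hasProd_one_sub_X_pow_mul (R := R) 2 two_ne_zero).tendsto_prod_nat
  refine tendsto_nhds_unique h1 ?_
  rw [tendsto_iff_coeff_tendsto] at h2 ⊢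
  intro d
  refine (h2 d).congr' (eventually_atTop.2 ⟨d + 1, fun n hn ↦ ?_⟩)
  have hu (i : ℕ) : IsUnit (1 - X ^ (2 * i + 1) : R⟦X⟧) := by
    rw [isUnit_iff_constantCoeff]; simp
  choose v hv using fun i ↦ (hu i).exists_right_inv
  obtain ⟨m, rfl⟩ : ∃ m, n = m + 1 := ⟨n - 1, by omega⟩
  beta_reduce
  -- Since `n > d`, every term with `s ≥ 1` carries `X ^ (s * (2 * n + 1))` and misses degree `d`;
  -- the term `s = 0` gives the partial product of `E_2`.
  rw [sum_pow_triangle_eq X v hv, sum_range_succ', add_mul, map_add]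
  have h3 : (∏ i ∈ Ico 0 (m + 1), (1 - (X : R⟦X⟧) ^ (2 * i + 2)) * v i) *
      ∏ i ∈ range (m + 1), (1 - X ^ (2 * i + 1)) = ∏ i ∈ range (m + 1), (1 - X ^ (2 * i + 2)) := by
    rw [range_eq_Ico, ← prod_mul_distrib]
    exact prod_congr rfl fun i _ ↦ by linear_combination (1 - X ^ (2 * i + 2)) * hv i
  rw [zero_mul, pow_zero, mul_one, h3]
  simp only [mul_add_one 2]
  rw [right_eq_add, sum_mul, map_sum]
  refine sum_eq_zero fun s _ ↦ ?_
  rw [mul_right_comm, coeff_mul_X_pow', if_neg]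
  nlinarith

end Topology

section GeneratingFunctions

variable (R : Type*) [CommRing R]

/-- Splitting `E_2` by the parity of `n` and factoring `1 - q ^ (4 k + 2)` gives `E_2 = D * ∏ (1 - q
^ (2 i + 1)) * E_4`; comparison with Gauss's identity lets the odd product cancel. -/
theorem distinctOdd_mul_expand_four_pentagonalSeries :
    (PowerSeries.mk fun n ↦ (#(distinctOddPartitions n) : R)) *
      expand 4 four_ne_zero (pentagonalSeries R) = triangularSeries R := by
  -- The claim is algebraic; the discrete topology only gives the infinite products a meaning.
  let : TopologicalSpace R := ⊥
  have : DiscreteTopology R := ⟨rfl⟩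
  set D : R⟦X⟧ := PowerSeries.mk fun n ↦ (#(distinctOddPartitions n) : R)
  have hD : HasProd (fun i ↦ (1 + X ^ (2 * i + 1) : R⟦X⟧)) D := by
    have h := hasProd_distinctOdd (R := R)
    have hinj : Function.Injective fun i : ℕ ↦ 2 * i := fun a b h ↦ by simpa using h
    rw [← hinj.hasProd_iff] at h
    · simpa [Function.comp_def] using h
    · intro x hx
      refine if_neg fun hodd ↦ hx ?_
      obtain ⟨k, hk⟩ := hodd
      exact ⟨k, by simp; omega⟩
  have hm : Multipliable fun i ↦ (1 - X ^ (2 * i + 1) : R⟦X⟧) := by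
    simpa [sub_eq_add_neg] using multipliable_one_add_C_mul_X_pow (-1 : R) (b := 1) two_ne_zero
  have h2 := hasProd_one_sub_X_pow_mul (R := R) 2 two_ne_zero
  have h4 := hasProd_one_sub_X_pow_mul (R := R) 4 four_ne_zero
  have h2' : HasProd (fun n ↦ (1 - X ^ (2 * (n + 1)) : R⟦X⟧))
      (D * (∏' i, (1 - X ^ (2 * i + 1) : R⟦X⟧)) * expand 4 four_ne_zero (pentagonalSeries R)) := by
    apply HasProd.even_mul_odd
    · convert hD.mul hm.hasProd using 2 with k
      ring
    · convert h4 using 2 with k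
      ring
  have he := h2.unique h2'
  have hu : IsUnit (∏' i, (1 - X ^ (2 * i + 1) : R⟦X⟧)) := by
    have h1 : IsUnit (expand 2 two_ne_zero (pentagonalSeries R)) := by
      rw [isUnit_iff_constantCoeff, constantCoeff_expand, ← coeff_zero_eq_constantCoeff_apply]
      have := coeff_pentagonalSeries_pentagonal R 0
      simp [pentagonal_def] at this
      simp [this]
    rw [he] at h1
    exact isUnit_of_mul_isUnit_right (isUnit_of_mul_isUnit_left h1)
  refine hu.mul_right_cancel ?_
  rw [triangularSeries_mul_tprod_one_sub_X_pow_odd, he]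
  ring

theorem fourDvd_mul_expand_four_pentagonalSeries :
    (PowerSeries.mk fun n ↦ (#(fourDvdPartitions n) : R)) *
      expand 4 four_ne_zero (pentagonalSeries R) = 1 := by
  let : TopologicalSpace R := ⊥
  have : DiscreteTopology R := ⟨rfl⟩
  have hinj : Function.Injective fun i : ℕ ↦ 4 * i + 3 := fun a b h ↦ by simpa using h
  have h := hasProd_fourDvd (R := R)
  rw [← hinj.hasProd_iff] at h
  · refine (h.mul (hasProd_one_sub_X_pow_mul (R := R) 4 four_ne_zero)).unique ?_
    convert hasProd_one using 2 with i
    simp only [Function.comp_apply]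
    rw [if_pos ⟨i + 1, by ring⟩]
    simp_rw [pow_mul, show 4 * i + 3 + 1 = 4 * (i + 1) by ring, ← pow_mul X 4]
    exact tsum_pow_mul_one_sub_of_constantCoeff_eq_zero (by simp)
  · intro x hx
    refine if_neg fun hd ↦ hx ?_
    obtain ⟨k, hk⟩ := hd
    exact ⟨k - 1, by simp; omega⟩

end GeneratingFunctions

/-! ### Reduction modulo 3 and the vanishing coefficient -/

theorem expand_twelve_pentagonalSeries :
    expand 12 (by simp) (pentagonalSeries (ZMod 3)) =
      expand 4 four_ne_zero (pentagonalSeries (ZMod 3)) ^ 3 := by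
  let : TopologicalSpace (ZMod 3) := ⊥
  have : DiscreteTopology (ZMod 3) := ⟨rfl⟩
  refine (hasProd_one_sub_X_pow_mul 12 (by simp)).unique ?_
  convert (hasProd_one_sub_X_pow_mul (R := ZMod 3) 4 four_ne_zero).pow 3 using 2 with n
  have h3 : (3 : (ZMod 3)⟦X⟧) = 0 := by
    have : C (3 : ZMod 3) = 3 := map_ofNat C 3
    rw [← this, show (3 : ZMod 3) = 0 from rfl, map_zero]
  linear_combination (X ^ (4 * (n + 1)) - X ^ (8 * (n + 1))) * h3

theorem coeff_card_partitionTriples_mul_expand (N : ℕ) :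
    coeff N ((PowerSeries.mk fun n ↦ (#(partitionTriples n) : ZMod 3)) *
      expand 12 (by simp) (pentagonalSeries (ZMod 3))) = coeff N (triangularSeries (ZMod 3) ^ 2) := by
  have h1 : (PowerSeries.mk fun n ↦ (#(partitionTriples n) : ZMod 3)) =
      (PowerSeries.mk fun n ↦ (#(distinctOddPartitions n) : ZMod 3)) *
      ((PowerSeries.mk fun n ↦ (#(distinctOddPartitions n) : ZMod 3)) *
      (PowerSeries.mk fun n ↦ (#(fourDvdPartitions n) : ZMod 3))) := by
    ext n
    rw [coeff_mul_mul_eq_card_partitionTriples, coeff_mk]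
  have h2 := fourDvd_mul_expand_four_pentagonalSeries (ZMod 3)
  rw [h1, expand_twelve_pentagonalSeries, ← distinctOdd_mul_expand_four_pentagonalSeries]
  refine congrArg (coeff N) ?_
  linear_combination ((PowerSeries.mk fun n ↦ (#(distinctOddPartitions n) : ZMod 3)) ^ 2 *
    expand 4 four_ne_zero (pentagonalSeries (ZMod 3)) ^ 2) * h2

theorem coeff_triangularSeries_sq_eq_zero {R : Type*} [CommRing R] {p N : ℕ} (hp : p.Prime)
    (hp4 : p % 4 = 3) (hN : p ∣ 4 * N + 1) (hN2 : ¬ p ^ 2 ∣ 4 * N + 1) :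
    coeff N (triangularSeries R ^ 2) = 0 := by
  rw [sq, coeff_mul]
  refine sum_eq_zero fun x hx ↦ ?_
  simp only [triangularSeries, coeff_mk]
  split_ifs with ha hb
  · obtain ⟨a, ha⟩ := ha
    obtain ⟨b, hb⟩ := hb
    exact (not_eq_triangular_add_triangular hp hp4 hN hN2 (mem_antidiagonal.1 hx) ha.symm hb.symm).elim
  all_goals simp

theorem support_negOnePow_mul_B_finite (N : ℕ) :
    (Function.support fun k : ℤ ↦ (k.negOnePow : ℤ) * (B (N - 6 * k * (3 * k + 1)) : ℤ)).Finite := by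
  refine ((Set.finite_Iic N).preimage
    (pentagonal_injective.comp neg_injective).injOn).subset fun k hk ↦ ?_
  by_contra h
  apply hk
  simp only [Set.mem_preimage, Function.comp_apply, Set.mem_Iic, not_le] at h
  have := two_mul_natCast_pentagonal_neg k
  beta_reduce
  rw [B, if_neg]
  · simp
  · have : 6 * k * (3 * k + 1) = 12 * pentagonal (-k) := by linarith
    omega

theorem finsum_negOnePow_mul_B (N : ℕ) :
    ((∑ᶠ k : ℤ, (k.negOnePow : ℤ) * (B (N - 6 * k * (3 * k + 1)) : ℤ) : ℤ) : ZMod 3) =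
      coeff N (triangularSeries (ZMod 3) ^ 2) := by
  have hfin := support_negOnePow_mul_B_finite N
  let : TopologicalSpace (ZMod 3) := ⊥
  have : DiscreteTopology (ZMod 3) := ⟨rfl⟩
  have h := (hasSum_pentagonalSeries (ZMod 3)).map (expand 12 (by simp)) (continuous_expand 12 (by simp))
  have h := (h.mul_left (PowerSeries.mk fun n ↦ (#(partitionTriples n) : ZMod 3))).map
    (coeff N) (continuous_coeff _ N)
  -- The flip `k ↦ -k` turns the exponents `k (3 k - 1) / 2` into `k (3 k + 1) / 2`.
  rw [coeff_card_partitionTriples_mul_expand, ← (Equiv.neg ℤ).hasSum_iff] at h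
  rw [← h.tsum_eq]
  refine ((Int.castAddHom (ZMod 3)).map_finsum hfin).trans ?_
  rw [← tsum_eq_finsum (L := .unconditional ℤ) (hfin.subset fun k hk h0 ↦ hk (by simp [h0]))]
  refine tsum_congr fun k ↦ ?_
  have hk := two_mul_natCast_pentagonal_neg k
  have hc : (((Int.negOnePow (-k) : ℤˣ) : ℤ) : (ZMod 3)⟦X⟧) = C (((k.negOnePow : ℤˣ) : ℤ) : ZMod 3) := by
    simp
  have hk' : 6 * k * (3 * k + 1) = 12 * pentagonal (-k) := by linarith
  simp only [Function.comp_apply, Equiv.neg_apply, map_mul, map_pow, expand_X, hc, expand_C,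
    Int.coe_castAddHom, Int.cast_mul, Int.cast_natCast, hk']
  rw [mul_left_comm, coeff_C_mul, ← pow_mul, coeff_mul_X_pow', coeff_mk, B]
  congr 1
  split_ifs with h1 h2 h2
  · rw [show ((N : ℤ) - 12 * (pentagonal (-k) : ℤ)).toNat = N - 12 * pentagonal (-k) by omega]
  · omega
  · omega
  · simp

theorem theorem1p4 (p : ℕ) (hp : p.Prime) (hp4 : p % 4 = 3) (hp5 : 5 ≤ p)
    (n r : ℕ) (hr1 : 1 ≤ r) (hr2 : r ≤ p - 1) :
    (Function.support fun k : ℤ =>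
        (k.negOnePow : ℤ) *
          (B (9 * (p : ℤ) ^ 2 * n + 9 * p * r + 9 * ((p : ℤ) ^ 2 - 1) / 4 + 2
            - 6 * k * (3 * k + 1)) : ℤ)).Finite ∧
    (∑ᶠ k : ℤ,
        (k.negOnePow : ℤ) *
          (B (9 * (p : ℤ) ^ 2 * n + 9 * p * r + 9 * ((p : ℤ) ^ 2 - 1) / 4 + 2
            - 6 * k * (3 * k + 1)) : ℤ)) ≡ 0 [ZMOD 3] := by
  obtain ⟨m, hm⟩ : ∃ m, p ^ 2 = 4 * m + 1 :=
    ⟨p ^ 2 / 4, by have : p ^ 2 % 4 = 1 := by rw [Nat.pow_mod, hp4]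
                   omega⟩
  have hdiv : 9 * ((p : ℤ) ^ 2 - 1) / 4 = 9 * m := by
    have : (p : ℤ) ^ 2 = 4 * m + 1 := by exact_mod_cast hm
    omega
  obtain ⟨N, hN⟩ : ∃ N : ℕ, N = 9 * p ^ 2 * n + 9 * p * r + 9 * m + 2 := ⟨_, rfl⟩
  have hNZ : 9 * (p : ℤ) ^ 2 * n + 9 * p * r + 9 * ((p : ℤ) ^ 2 - 1) / 4 + 2 = N := by
    rw [hdiv, hN]; push_cast; rfl
  simp only [hNZ]
  refine ⟨support_negOnePow_mul_B_finite N, ?_⟩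
  -- The shift `9 m + 2` makes the constant term `36 m + 9 = 9 p ^ 2`.
  have hN4 : 4 * N + 1 = p * (p * (36 * n + 9) + 36 * r) := by linarith
  refine (ZMod.intCast_eq_intCast_iff _ _ 3).1 ?_
  rw [finsum_negOnePow_mul_B, Int.cast_zero]
  refine coeff_triangularSeries_sq_eq_zero hp hp4 (Dvd.intro _ hN4.symm) fun hd ↦ ?_
  rw [hN4, sq, Nat.mul_dvd_mul_iff_left hp.pos, Nat.dvd_add_right (dvd_mul_right p _),
    hp.dvd_mul] at hd
  rcases hd with h | h
  -- A second factor `p` would divide `36 r`, impossible for `p ≥ 5` and `0 < r < p`.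
  · rw [show 36 = 2 ^ 2 * 3 ^ 2 by rfl, hp.dvd_mul] at h
    rcases h with h | h <;> have := Nat.le_of_dvd (by simp) (hp.dvd_of_dvd_pow h) <;> omega
  · have := Nat.le_of_dvd hr1 h
    omega
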